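/- Conventions. All manifolds and Lie groups are smooth, Hausdorff and modelled on real Hausdorff locally convex spaces (possibly infinite-dimensional), smoothness being understood in the sense of Bastiani (all iterated directional derivatives exist and are jointly continuous); this includes the finite-dimensional and the Banach case. For a smooth left action of a Lie group $G$ on $P$, write $\xi^*_p=\xi\cdot p$ for the fundamental vector field of $\xi\in\mathfrak g=T_1G$ and $g\cdot X$ for the tangent action. *Klein pair.* A Klein pair $(\mathfrak a,\mathfrak g)$ with group $G$ consists of a locally convex topological Lie algebra $\mathfrak a$, a closed, topologically complemented Lie subalgebra $\mathfrak g\subseteq\mathfrak a$ identified (as a topological Lie algebra) with the Lie algebra of the Lie group $G$, and a smooth representation $\mathrm{Ad}$ of $G$ on $\mathfrak a$ which restricts to the adjoint representation on $\mathfrak g$. *Cartan geometry.* A Cartan geometry $(P,\theta)$ modelled on it is a left principal $G$-bundle $\pi:P\to B$ with a smooth 1-form $\theta\in\Omega^1(P,\mathfrak a)$ such that every $\theta_p:T_pP\to\mathfrak a$ is an isomorphism (of topological vector spaces), $\theta_{g\cdot p}(g\cdot X)=\mathrm{Ad}_g\,\theta_p(X)$, and $\theta(\xi^*)=\xi$ for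 $\xi\in\mathfrak g$. It is torsion-free if its curvature $\Omega=d\theta-\tfrac12[\theta\wedge\theta]$, where $[\theta\wedge\theta](X,Y)=2[\theta(X),\theta(Y)]$, takes values in $\mathfrak g$. *Cartan model.* Let $G$ act smoothly on a manifold $M$ and let $m\in M$. The Cartan geometry is a Cartan model for the orbit through $m$ if it comes with a smooth $G$-equivariant map $\chi:P\to M$ whose image contains $m$, a Lie subalgebra $\mathfrak a_m\subseteq\mathfrak a$, and a right Lie algebra action of $\mathfrak a_m$ on $P$ (a linear map $\zeta\mapsto\zeta^*$, $\zeta^*_p=p\cdot\zeta$, to smooth vector fields with $[\zeta,\eta]^*=[\zeta^*,\eta^*]$) which commutes with the $G$-action and satisfies $T\chi(\zeta^*)=0$. Put $\rho_p(\xi)=T_p\chi(\theta_p^{-1}(\xi))$ for $\xi\in\mathfrak a$. *Dualities.* Let $\mathfrak g^*$ be a locally convex space with a non-degenerate bilinear pairing $\kappa:\mathfrak g^*\times\mathfrak g\to\mathbb R$ for which the coadjoint action exists on $\mathfrak g^*$, i.e. $\kappa(\mathrm{Ad}^*_{g^{-1}}\mu,\xi)=\kappa(\mu,\mathrm{Ad}_{g^{-1}}\xi)$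 defines $\mathrm{Ad}^*_{g^{-1}}\mu\in\mathfrak g^*$. A duality of the Klein pair is a bilinear, (at least sequentially) continuous map $\kappa_{\mathfrak a}:\mathfrak g^*\times\mathfrak a\to\mathbb R$ with $\kappa_{\mathfrak a}(\mathrm{Ad}^*_{g^{-1}}\mu,\mathrm{Ad}_g\xi)=\kappa_{\mathfrak a}(\mu,\xi)$ which vanishes on $\mathfrak g^*\times\mathfrak g$. *Equivariance.* Let $(M,\omega)$ be a (possibly weakly) symplectic manifold on which $G$ acts smoothly and symplectically with smooth momentum map $J:M\to\mathfrak g^*$, i.e. $\omega_x(\xi\cdot x,X)+\kappa(T_xJ(X),\xi)=0$. Let $C_p=T_{\chi(p)}J\circ\rho_p:\mathfrak a\to\mathfrak g^*$. The momentum map is $\mathfrak a$-equivariant if $$\kappa_{\mathfrak a}(C_p\xi,\eta)-\kappa_{\mathfrak a}(C_p\eta,\xi)=-\kappa_{\mathfrak a}\bigl(J(\chi(p)),[\xi,\eta]\bigr)\qquad(p\in P,\ \xi,\eta\in\mathfrak a)$$ and the non-equivariance cocycle $\sigma(g)=J(g\cdot x)-\mathrm{Ad}^*_{g^{-1}}J(x)$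 satisfies $\kappa_{\mathfrak a}(\sigma(g),\xi)=0$ for all $g\in G$, $\xi\in\mathfrak a$ (and all $x\in M$, in case $M$ is disconnected and $\sigma(g)$ depends on $x$). **Theorem.** Let $(M,\omega)$ be a symplectic manifold and $G$ a Lie group acting symplectically on $M$ with momentum map $J:M\to\mathfrak g^*$. Let $(P,\theta)$ be a Cartan model for the orbit through $m\in M$ and $\kappa_{\mathfrak a}$ a duality of the underlying Klein pair $(\mathfrak a,\mathfrak g)$. Assume that $J$ is $\mathfrak a$-equivariant and that $\theta$ is torsion-free. Let $\zeta\in\mathfrak a_m$ be such that the Lie derivative $L_{\zeta^*}\theta$ takes values in $\mathfrak g$. Then the function $$\tilde F_\zeta:P\to\mathbb R,\qquad \tilde F_\zeta(p)=\kappa_{\mathfrak a}\bigl(J(\chi(p)),\theta_p(p\cdot\zeta)\bigr)$$ descends to a unique function $F_\zeta:B\to\mathbb R$ with $F_\zeta\circ\pi=\tilde F_\zeta$, and $F_\zeta$ is locally constant; in particular it is constant on the connected components of $B$. -/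

import Mathlib

open Set Filter Topology

noncomputable section

namespace CartanGIT

universe u v

/-! ## Calculus in locally convex spaces (Bastiani, Milnor, Hamilton, Neeb) -/

/-- Real Hausdorff locally convex topological vector spaces. -/
class IsLCS (E : Type*) [AddCommGroup E] [Module ℝ E] [TopologicalSpace E] : Prop
    extends IsTopologicalAddGroup E, ContinuousSMul ℝ E, LocallyConvexSpace ℝ E, T2Space E

section Calculus

variable {E : Type*} [AddCommGroup E] [Module ℝ E]
variable {F : Type*} [AddCommGroup F] [Module ℝ F] [TopologicalSpace F]

/-- `f` has directional derivative `w` at `x` in the direction `v`. -/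
def HasDirDeriv (f : E → F) (w : F) (x v : E) : Prop :=
  Tendsto (fun t : ℝ => t⁻¹ • (f (x + t • v) - f x)) (𝓝[≠] 0) (𝓝 w)

/-- The directional derivative of `f` at `x` in the direction `v`
(it is only used where it exists). -/
def dirDeriv (f : E → F) (x v : E) : F :=
  limUnder (𝓝[≠] (0 : ℝ)) (fun t : ℝ => t⁻¹ • (f (x + t • v) - f x))

end Calculus

section Smooth

variable {F : Type v} [AddCommGroup F] [Module ℝ F] [TopologicalSpace F]

/-- `f` is `C^n` on the open set `U`: it is continuous and, for `n ≥ 1`, all its directional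
derivatives exist on `U` and `(x, v) ↦ df(x; v)` is `C^(n-1)` on `U × E`. -/
def BastianiContDiffOn : ℕ → ∀ {E : Type u} [AddCommGroup E] [Module ℝ E] [TopologicalSpace E],
    (E → F) → Set E → Prop
  | 0, _, _, _, _, f, U => ContinuousOn f U
  | n + 1, E, _, _, _, f, U => ContinuousOn f U ∧ ∃ f' : E × E → F,
      (∀ x ∈ U, ∀ w, HasDirDeriv f (f' (x, w)) x w) ∧
        BastianiContDiffOn n f' (U ×ˢ (univ : Set E))

/-- `f` is smooth on the open set `U`. -/
def BSmoothOn {E : Type u} [AddCommGroup E] [Module ℝ E] [TopologicalSpace E]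
    (f : E → F) (U : Set E) : Prop :=
  ∀ n : ℕ, BastianiContDiffOn n f U

end Smooth

/-! ## Manifolds modelled on locally convex spaces -/

/-- `M` is a smooth (Hausdorff) manifold modelled on the locally convex space `E`. -/
class LCManifold (E : Type*) [AddCommGroup E] [Module ℝ E] [TopologicalSpace E]
    (M : Type*) [TopologicalSpace M] [ChartedSpace E M] : Prop extends T2Space M where
  smooth_transition : ∀ φ ∈ atlas E M, ∀ ψ ∈ atlas E M,
    BSmoothOn (fun u : E => ψ (φ.symm u)) (φ.target ∩ φ.symm ⁻¹' ψ.source)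

/-- The tangent space at `x`, identified with the model space through the preferred chart
`chartAt E x` at `x`. -/
abbrev TangentAt (E : Type*) {M : Type*} (_x : M) : Type _ := E

section Maps

variable (E : Type*) [AddCommGroup E] [Module ℝ E] [TopologicalSpace E]
variable (F : Type*) [AddCommGroup F] [Module ℝ F] [TopologicalSpace F]
variable {M : Type*} [TopologicalSpace M] [ChartedSpace E M]
variable {N : Type*} [TopologicalSpace N] [ChartedSpace F N]

/-- `f` read in the preferred charts at `x` and `f x`. -/
def localRep (f : M → N) (x : M) : E → F :=
  fun u => chartAt F (f x) (f ((chartAt E x).symm u))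

/-- Smoothness of a map between manifolds on an open subset `U`. -/
def SmoothMapOn (f : M → N) (U : Set M) : Prop :=
  ContinuousOn f U ∧ ∀ x ∈ U, BSmoothOn (localRep E F f x)
    ((chartAt E x).target ∩ (chartAt E x).symm ⁻¹' (U ∩ f ⁻¹' (chartAt F (f x)).source))

/-- Smoothness of a map between manifolds. -/
def SmoothMap (f : M → N) : Prop := SmoothMapOn E F f univ

/-- The tangent map `T_x f : T_x M → T_{f x} N`. -/
def tangentMap (f : M → N) (x : M) (X : TangentAt E x) : TangentAt F (f x) :=
  dirDeriv (localRep E F f x) (chartAt E x x) X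

end Maps

section Products

variable (E₁ : Type*) [AddCommGroup E₁] [Module ℝ E₁] [TopologicalSpace E₁]
variable (E₂ : Type*) [AddCommGroup E₂] [Module ℝ E₂] [TopologicalSpace E₂]
variable (F : Type*) [AddCommGroup F] [Module ℝ F] [TopologicalSpace F]
variable {M₁ : Type*} [TopologicalSpace M₁] [ChartedSpace E₁ M₁]
variable {M₂ : Type*} [TopologicalSpace M₂] [ChartedSpace E₂ M₂]
variable {N : Type*} [TopologicalSpace N] [ChartedSpace F N]

/-- Smoothness, on an open subset, of a map defined on the product manifold `M₁ × M₂`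
(with the product charts, in the model space `E₁ × E₂`). -/
def SmoothMapOn₂ (f : M₁ × M₂ → N) (U : Set (M₁ × M₂)) : Prop :=
  letI : ChartedSpace (E₁ × E₂) (M₁ × M₂) := prodChartedSpace E₁ M₁ E₂ M₂
  SmoothMapOn (E₁ × E₂) F f U

/-- Smoothness of a map defined on the product manifold `M₁ × M₂`. -/
def SmoothMap₂ (f : M₁ × M₂ → N) : Prop := SmoothMapOn₂ E₁ E₂ F f univ

end Products

/-! ## Vector fields and differential forms -/

section Tensors

variable (E : Type*) [AddCommGroup E] [Module ℝ E] [TopologicalSpace E]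
variable {M : Type*} [TopologicalSpace M] [ChartedSpace E M]
variable {V : Type*} [AddCommGroup V] [Module ℝ V] [TopologicalSpace V]

/-- Coordinates, in the chart `chartAt E x`, of a tangent vector `Y` at `y`. -/
def toChart (x y : M) (Y : TangentAt E y) : E :=
  dirDeriv (fun u : E => chartAt E x ((chartAt E y).symm u)) (chartAt E y y) Y

/-- The tangent vector at the point `(chartAt E x).symm u` whose coordinates in the chart
`chartAt E x` are `w`. -/
def fromChart (x : M) (u w : E) : TangentAt E ((chartAt E x).symm u) :=
  dirDeriv (fun u' : E => chartAt E ((chartAt E x).symm u) ((chartAt E x).symm u')) u w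

/-- The vector field `Z` read in the chart `chartAt E x`. -/
def localField (Z : ∀ p : M, TangentAt E p) (x : M) (u : E) : E :=
  toChart E x ((chartAt E x).symm u) (Z ((chartAt E x).symm u))

/-- The `V`-valued 1-form `θ` read in the chart `chartAt E x`. -/
def localForm (θ : ∀ p : M, TangentAt E p →L[ℝ] V) (x : M) (u w : E) : V :=
  θ ((chartAt E x).symm u) (fromChart E x u w)

/-- The bilinear form field `ω` read in the chart `chartAt E x`. -/
def localForm₂ (ω : ∀ p : M, TangentAt E p →ₗ[ℝ] TangentAt E p →ₗ[ℝ] ℝ) (x : M)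
    (u w₁ w₂ : E) : ℝ :=
  ω ((chartAt E x).symm u) (fromChart E x u w₁) (fromChart E x u w₂)

/-- Smooth vector fields. -/
def IsSmoothField (Z : ∀ p : M, TangentAt E p) : Prop :=
  ∀ x : M, BSmoothOn (localField E Z x) (chartAt E x).target

/-- Smooth `V`-valued 1-forms. -/
def IsSmoothForm (θ : ∀ p : M, TangentAt E p →L[ℝ] V) : Prop :=
  ∀ x : M, BSmoothOn (fun q : E × E => localForm E θ x q.1 q.2)
    ((chartAt E x).target ×ˢ (univ : Set E))

/-- The Lie bracket `[Z, W]` of vector fields, `[Z, W] = DW(Z) - DZ(W)` in a chart. -/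
def fieldBracket (Z W : ∀ p : M, TangentAt E p) (p : M) : TangentAt E p :=
  dirDeriv (localField E W p) (chartAt E p p) (Z p) -
    dirDeriv (localField E Z p) (chartAt E p p) (W p)

/-- The exterior derivative of a 1-form: `dθ(X, Y) = D_X θ(Y) - D_Y θ(X)` in a chart. -/
def extDerivForm (θ : ∀ p : M, TangentAt E p →L[ℝ] V) (p : M) (X Y : TangentAt E p) : V :=
  dirDeriv (fun u => localForm E θ p u Y) (chartAt E p p) X -
    dirDeriv (fun u => localForm E θ p u X) (chartAt E p p) Y

/-- The Lie derivative of a 1-form along a vector field: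
`(L_Z θ)(X) = (D_Z θ)(X) + θ(D_X Z)` in a chart. -/
def lieDerivForm (Z : ∀ p : M, TangentAt E p) (θ : ∀ p : M, TangentAt E p →L[ℝ] V) (p : M)
    (X : TangentAt E p) : V :=
  dirDeriv (fun u => localForm E θ p u X) (chartAt E p p) (Z p) +
    θ p (dirDeriv (localField E Z p) (chartAt E p p) X)

/-- Symplectic forms (weakly non-degenerate ones are allowed in infinite dimensions):
smooth, alternating, closed and non-degenerate. -/
structure IsSymplecticForm (ω : ∀ p : M, TangentAt E p →ₗ[ℝ] TangentAt E p →ₗ[ℝ] ℝ) :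
    Prop where
  smooth : ∀ x : M, BSmoothOn (fun q : E × (E × E) => localForm₂ E ω x q.1 q.2.1 q.2.2)
    ((chartAt E x).target ×ˢ (univ : Set (E × E)))
  alternating : ∀ (p : M) (X : TangentAt E p), ω p X X = 0
  closed : ∀ (p : M) (X Y Z : TangentAt E p),
    dirDeriv (fun u => localForm₂ E ω p u Y Z) (chartAt E p p) X -
      dirDeriv (fun u => localForm₂ E ω p u X Z) (chartAt E p p) Y +
        dirDeriv (fun u => localForm₂ E ω p u X Y) (chartAt E p p) Z = 0
  nondegenerate : ∀ (p : M) (X : TangentAt E p), (∀ Y, ω p X Y = 0) → X = 0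

end Tensors

/-- `[α ∧ β](X, Y) = [α(X), β(Y)] - [α(Y), β(X)]` for Lie algebra valued 1-forms. -/
def wedgeLie {E : Type*} [AddCommGroup E] [Module ℝ E] [TopologicalSpace E] {M : Type*}
    {A : Type*} [LieRing A] [LieAlgebra ℝ A] [TopologicalSpace A]
    (α β : ∀ p : M, TangentAt E p →L[ℝ] A) (p : M) (X Y : TangentAt E p) : A :=
  ⁅α p X, β p Y⁆ - ⁅α p Y, β p X⁆

/-! ## Lie groups, their Lie algebras and actions -/

section Groups

variable (EG : Type*) [AddCommGroup EG] [Module ℝ EG] [TopologicalSpace EG]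
variable (G : Type*) [Group G] [TopologicalSpace G] [ChartedSpace EG G]

/-- `G` is a Lie group modelled on the locally convex space `EG`. -/
class LCLieGroup : Prop extends LCManifold EG G where
  smooth_mul : SmoothMap₂ EG EG EG (fun q : G × G => q.1 * q.2)
  smooth_inv : SmoothMap EG EG (fun g : G => g⁻¹)

variable {G}

/-- The adjoint action of `g` on the Lie algebra `T_1 G`: the tangent map at `1` of
`h ↦ g h g⁻¹`. -/
def adjoint (g : G) (ξ : EG) : EG :=
  tangentMap EG EG (fun h : G => g * h * g⁻¹) (1 : G) ξ

variable (G)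

/-- The Lie bracket of the Lie algebra `T_1 G`: the derivative at `1` in the direction `ξ` of
`g ↦ Ad_g η` (this is the bracket of left invariant vector fields). -/
def groupBracket (ξ η : EG) : EG :=
  dirDeriv (fun u : EG => adjoint EG ((chartAt EG (1 : G)).symm u) η) (chartAt EG (1 : G) 1) ξ

variable (EX : Type*) [AddCommGroup EX] [Module ℝ EX] [TopologicalSpace EX]
variable (X : Type*) [TopologicalSpace X] [ChartedSpace EX X] [MulAction G X]

/-- The left action of `G` on the manifold `X` is smooth. -/
def IsSmoothAction : Prop := SmoothMap₂ EG EX EX (fun q : G × X => q.1 • q.2)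

variable {X}

/-- The fundamental vector field `ξ ↦ ξ* = (p ↦ ξ . p)` of the action. -/
def fundamentalField (ξ : EG) (p : X) : TangentAt EX p :=
  tangentMap EG EX (fun g : G => g • p) (1 : G) ξ

/-- `T_p (g ·)`, the tangent map of the action of `g`. -/
def actTangent {G : Type*} [Group G] [MulAction G X] (g : G) (p : X) (Y : TangentAt EX p) :
    TangentAt EX (g • p) :=
  tangentMap EX EX (fun q : X => g • q) p Y

/-- `π : P → B` is a left principal `G`-bundle: `G` acts smoothly on `P`, `π` is smooth and
invariant, and `B` is covered by open sets `U` with a `G`-equivariant diffeomorphism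
`π⁻¹(U) ≃ G × U`, `p ↦ (τ p, π p)`, with inverse `(g, b) ↦ s (g, b)`. -/
structure IsPrincipalBundle (EP : Type*) [AddCommGroup EP] [Module ℝ EP] [TopologicalSpace EP]
    {P : Type*} [TopologicalSpace P] [ChartedSpace EP P] [MulAction G P]
    (EB : Type*) [AddCommGroup EB] [Module ℝ EB] [TopologicalSpace EB]
    {B : Type*} [TopologicalSpace B] [ChartedSpace EB B] (π : P → B) : Prop where
  smooth_action : IsSmoothAction EG G EP P
  smooth_proj : SmoothMap EP EB π
  proj_smul : ∀ (g : G) (p : P), π (g • p) = π p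
  locally_trivial : ∀ b : B, ∃ U : Set B, IsOpen U ∧ b ∈ U ∧
    ∃ (τ : P → G) (s : G × B → P),
      SmoothMapOn EP EG τ (π ⁻¹' U) ∧
      SmoothMapOn₂ EG EB EP s (univ ×ˢ U) ∧
      (∀ (g : G) (p : P), π p ∈ U → τ (g • p) = g * τ p) ∧
      (∀ (g : G), ∀ c ∈ U, π (s (g, c)) = c ∧ τ (s (g, c)) = g) ∧
      (∀ p : P, π p ∈ U → s (τ p, π p) = p)

end Groups

/-! ## Klein pairs and Cartan geometries -/

/-- A Klein pair `(𝔞, 𝔤)` with group `G`: a topological Lie algebra `𝔞 = A`, a closed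
topologically complemented Lie subalgebra `𝔤`, an identification of the Lie algebra of the Lie
group `G` with `𝔤`, and a representation of `G` on `𝔞` extending the adjoint representation
of `G` on `𝔤`. -/
structure KleinPair (EG : Type*) [AddCommGroup EG] [Module ℝ EG] [TopologicalSpace EG]
    (G : Type*) [Group G] [TopologicalSpace G] [ChartedSpace EG G]
    (A : Type*) [LieRing A] [LieAlgebra ℝ A] [TopologicalSpace A] where
  continuous_bracket : Continuous (fun q : A × A => ⁅q.1, q.2⁆)
  /-- the subalgebra `𝔤` -/
  sub : LieSubalgebra ℝ A
  closed_sub : IsClosed (sub : Set A)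
  complemented_sub : sub.toSubmodule.ClosedComplemented
  /-- the identification `T_1 G ≃ 𝔤` -/
  incl : EG ≃L[ℝ] sub
  incl_bracket : ∀ ξ η : EG, incl (groupBracket EG G ξ η) = ⁅incl ξ, incl η⁆
  /-- the representation `Ad` of `G` on `𝔞` -/
  Ad : G →* (A →L[ℝ] A)
  smooth_Ad : SmoothMap₂ EG A A (fun q : G × A => Ad q.1 q.2)
  Ad_incl : ∀ (g : G) (ξ : EG), Ad g (incl ξ : A) = (incl (adjoint EG g ξ) : A)

section Cartan

variable {EG : Type*} [AddCommGroup EG] [Module ℝ EG] [TopologicalSpace EG]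
variable {G : Type*} [Group G] [TopologicalSpace G] [ChartedSpace EG G]
variable {A : Type*} [LieRing A] [LieAlgebra ℝ A] [TopologicalSpace A]

/-- A Cartan geometry modelled on the Klein pair `K` with group `G`: a left principal
`G`-bundle `π : P → B` with a Cartan connection `θ`. -/
structure CartanGeometry (K : KleinPair EG G A)
    (EP : Type*) [AddCommGroup EP] [Module ℝ EP] [TopologicalSpace EP]
    (P : Type*) [TopologicalSpace P] [ChartedSpace EP P] [MulAction G P]
    (EB : Type*) [AddCommGroup EB] [Module ℝ EB] [TopologicalSpace EB]
    (B : Type*) [TopologicalSpace B] [ChartedSpace EB B] where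
  /-- the bundle projection -/
  π : P → B
  principal : IsPrincipalBundle EG G EP EB π
  /-- the Cartan connection, an isomorphism `T_p P ≃ 𝔞` at each `p` -/
  θ : ∀ p : P, TangentAt EP p ≃L[ℝ] A
  smooth : IsSmoothForm EP (fun p => (θ p : TangentAt EP p →L[ℝ] A))
  equivariant : ∀ (g : G) (p : P) (X : TangentAt EP p),
    θ (g • p) (actTangent EP g p X) = K.Ad g (θ p X)
  fundamental : ∀ (ξ : EG) (p : P), θ p (fundamentalField EG G EP ξ p) = (K.incl ξ : A)

variable {K : KleinPair EG G A}
variable {EP : Type*} [AddCommGroup EP] [Module ℝ EP] [TopologicalSpace EP]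
variable {P : Type*} [TopologicalSpace P] [ChartedSpace EP P] [MulAction G P]
variable {EB : Type*} [AddCommGroup EB] [Module ℝ EB] [TopologicalSpace EB]
variable {B : Type*} [TopologicalSpace B] [ChartedSpace EB B]

namespace CartanGeometry

/-- The Cartan connection as an `𝔞`-valued 1-form on `P`. -/
def form (C : CartanGeometry K EP P EB B) (p : P) : TangentAt EP p →L[ℝ] A := C.θ p

/-- The curvature `Ω = dθ - (1/2) [θ ∧ θ]`. -/
def curvature (C : CartanGeometry K EP P EB B) (p : P) (X Y : TangentAt EP p) : A :=
  extDerivForm EP C.form p X Y - (1 / 2 : ℝ) • wedgeLie C.form C.form p X Y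

/-- `θ` is torsion-free: its curvature takes values in `𝔤`. -/
def TorsionFree (C : CartanGeometry K EP P EB B) : Prop :=
  ∀ (p : P) (X Y : TangentAt EP p), C.curvature p X Y ∈ K.sub

end CartanGeometry

variable {EM : Type*} [AddCommGroup EM] [Module ℝ EM] [TopologicalSpace EM]
variable {M : Type*} [TopologicalSpace M] [ChartedSpace EM M] [MulAction G M]

/-- A Cartan model for the orbit through `m ∈ M`. -/
structure OrbitModel (EM : Type*) [AddCommGroup EM] [Module ℝ EM] [TopologicalSpace EM]
    {M : Type*} [TopologicalSpace M] [ChartedSpace EM M] [MulAction G M]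
    (C : CartanGeometry K EP P EB B) (m : M) where
  /-- the modelling map -/
  χ : P → M
  smooth : SmoothMap EP EM χ
  equivariant : ∀ (g : G) (p : P), χ (g • p) = g • χ p
  mem_range : m ∈ range χ
  /-- the Lie subalgebra `𝔞_m` -/
  stab : LieSubalgebra ℝ A
  /-- the right Lie algebra action `ζ ↦ ζ* = (p ↦ p . ζ)` of `𝔞_m` on `P` -/
  act : stab →ₗ[ℝ] (∀ p : P, TangentAt EP p)
  smooth_act : ∀ ζ : stab, IsSmoothField EP (act ζ)
  act_bracket : ∀ (ζ η : stab) (p : P), act ⁅ζ, η⁆ p = fieldBracket EP (act ζ) (act η) p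
  act_commutes : ∀ (ζ : stab) (g : G) (p : P), actTangent EP g p (act ζ p) = act ζ (g • p)
  tangent_act : ∀ (ζ : stab) (p : P), tangentMap EP EM χ p (act ζ p) = 0

namespace OrbitModel

/-- The infinitesimal action `ρ_p(ξ) = ξ . χ(p) = T_p χ (θ_p⁻¹ ξ)` of `𝔞`. -/
def infAction {C : CartanGeometry K EP P EB B} {m : M} (O : OrbitModel EM C m) (p : P) (ξ : A) :
    TangentAt EM (O.χ p) :=
  tangentMap EP EM O.χ p ((C.θ p).symm ξ)

end OrbitModel

/-! ## Dualities and momentum maps -/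

/-- A duality of the Lie algebra of `G`: a space `D = 𝔤^*` with a non-degenerate pairing with
`T_1 G`, such that the coadjoint action of `G` exists on `D`. -/
structure LieDuality (EG : Type*) [AddCommGroup EG] [Module ℝ EG] [TopologicalSpace EG]
    (G : Type*) [Group G] [TopologicalSpace G] [ChartedSpace EG G]
    (D : Type*) [AddCommGroup D] [Module ℝ D] where
  /-- the pairing -/
  κ : D →ₗ[ℝ] EG →ₗ[ℝ] ℝ
  nondegenerate : κ.Nondegenerate
  coadjoint_exists : ∀ (g : G) (μ : D), ∃ ν : D, ∀ ξ : EG, κ ν ξ = κ μ (adjoint EG g⁻¹ ξ)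

variable {D : Type*} [AddCommGroup D] [Module ℝ D] [TopologicalSpace D]

/-- The coadjoint (left) action of `G` on `𝔤^*`:
`κ (coad g μ, ξ) = κ (μ, Ad_{g⁻¹} ξ)` for all `ξ`. -/
def LieDuality.coad (k : LieDuality EG G D) (g : G) (μ : D) : D :=
  Classical.choose (k.coadjoint_exists g μ)

/-- A duality `κ_𝔞 : 𝔤^* × 𝔞 → ℝ` of the Klein pair `(𝔞, 𝔤)`: a (sequentially continuous)
bilinear map which is `Ad_G`-invariant and vanishes on `𝔤^* × 𝔤`. -/
structure KleinDuality (K : KleinPair EG G A) (k : LieDuality EG G D) where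
  /-- the pairing -/
  κ : D →ₗ[ℝ] A →ₗ[ℝ] ℝ
  seqContinuous : SeqContinuous (fun q : D × A => κ q.1 q.2)
  invariant : ∀ (g : G) (μ : D) (ξ : A), κ (k.coad g μ) (K.Ad g ξ) = κ μ ξ
  vanishes : ∀ (μ : D), ∀ ξ ∈ K.sub, κ μ ξ = 0

/-- `G` acts symplectically (and smoothly) on `(M, ω)`. -/
structure IsSymplecticAction (EG : Type*) [AddCommGroup EG] [Module ℝ EG] [TopologicalSpace EG]
    (G : Type*) [Group G] [TopologicalSpace G] [ChartedSpace EG G]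
    {EM : Type*} [AddCommGroup EM] [Module ℝ EM] [TopologicalSpace EM]
    {M : Type*} [TopologicalSpace M] [ChartedSpace EM M] [MulAction G M]
    (ω : ∀ x : M, TangentAt EM x →ₗ[ℝ] TangentAt EM x →ₗ[ℝ] ℝ) : Prop where
  smooth : IsSmoothAction EG G EM M
  symplectic : ∀ (g : G) (x : M) (X Y : TangentAt EM x),
    ω (g • x) (actTangent EM g x X) (actTangent EM g x Y) = ω x X Y

/-- `J : M → 𝔤^*` is a momentum map: `ω_x(ξ . x, X) + κ(T_x J(X), ξ) = 0`. -/
structure IsMomentumMap (ω : ∀ x : M, TangentAt EM x →ₗ[ℝ] TangentAt EM x →ₗ[ℝ] ℝ)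
    (k : LieDuality EG G D) (J : M → D) : Prop where
  smooth : SmoothMap EM D J
  momentum : ∀ (x : M) (X : TangentAt EM x) (ξ : EG),
    ω x (fundamentalField EG G EM ξ x) X + k.κ (tangentMap EM D J x X) ξ = 0

/-- The non-equivariance cocycle `σ(g) = J(g · x) - Ad^*_{g⁻¹} J(x)`, computed at `x`
(it does not depend on `x` if `M` is connected). -/
def nonequivarianceCocycle (k : LieDuality EG G D) (J : M → D) (g : G) (x : M) : D :=
  J (g • x) - k.coad g (J x)

/-- The Calabi operator `C_p = T_{χ(p)} J ∘ ρ_p : 𝔞 → 𝔤^*`. -/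
def calabi {C : CartanGeometry K EP P EB B} {m : M} (O : OrbitModel EM C m) (J : M → D)
    (p : P) (ξ : A) : D :=
  tangentMap EM D J (O.χ p) (O.infAction p ξ)

/-- `J` is `𝔞`-equivariant relative to `κ_𝔞`. -/
structure IsAEquivariant {C : CartanGeometry K EP P EB B} {m : M} (O : OrbitModel EM C m)
    {k : LieDuality EG G D} (ka : KleinDuality K k) (J : M → D) : Prop where
  calabi_comm : ∀ (p : P) (ξ η : A),
    ka.κ (calabi O J p ξ) η - ka.κ (calabi O J p η) ξ = - ka.κ (J (O.χ p)) ⁅ξ, η⁆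
  cocycle : ∀ (g : G) (x : M) (ξ : A), ka.κ (nonequivarianceCocycle k J g x) ξ = 0

/-- The function `p ↦ κ_𝔞 (J (χ p), θ_p (p . ζ))` on `P`; the generalized Futaki invariant is
the function on `B` to which it descends. -/
def futakiLift {C : CartanGeometry K EP P EB B} {m : M} (O : OrbitModel EM C m)
    {k : LieDuality EG G D} (ka : KleinDuality K k) (J : M → D) (ζ : O.stab) (p : P) : ℝ :=
  ka.κ (J (O.χ p)) (C.θ p (O.act ζ p))

end Cartan

end CartanGIT

end

/-! Write `Z` for `ζ*`. The lift is `G`-invariant: since `Z` commutes with `G`, `θ(Z)` transforms by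
`Ad_g`; the cocycle condition lets `J(g·x)` be replaced by the coadjoint translate of `J(x)` inside
`κ_𝔞`, and the pairing is `Ad`-invariant (`futakiLift_smul`). As `G` is transitive on the fibres,
the lift descends.

For local constancy, differentiate in the direction `X`. The product rule gives `κ_𝔞(TJ Tχ X, θ(Z))
+ κ_𝔞(J, X(θ(Z)))`, and Cartan's formula gives `X(θ(Z)) = dθ(X, Z) + (L_Z θ)(X)`. Modulo `𝔤`, which
`κ_𝔞` annihilates, the Lie derivative vanishes and torsion-freeness turns `dθ(X, Z)` into `[θ(X),
θ(Z)]`. The first term is `κ_𝔞(C_p θ(X), θ(Z))`; since `C_p θ(Z) = TJ Tχ Z = 0`, `𝔞`-equivariance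
makes it `-κ_𝔞(J, [θ(X), θ(Z)])`, and the two cancel (`HasVelocity.futakiLift`).

The analysis is done along curves. Hahn–Banach reduces the mean value theorem to the scalar one;
with joint continuity of the derivative this yields `tendsto_smul_sub_of_hasDirDeriv`, hence the
chain rule and additivity. `IsPrincipalBundle.isLocallyConstant` transfers vanishing derivatives to
the base by lifting chart segments through local sections. -/

namespace CartanGIT

/-! ### Differential calculus in locally convex spaces. -/

section LocallyConvexCalculus

variable {E : Type*} [AddCommGroup E] [Module ℝ E]
variable {F : Type*} [AddCommGroup F] [Module ℝ F] [TopologicalSpace F]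

theorem HasDirDeriv.dirDeriv_eq [T2Space F] {f : E → F} {w : F} {x v : E}
    (h : HasDirDeriv f w x v) : dirDeriv f x v = w :=
  Tendsto.limUnder_eq h

theorem hasDirDeriv_iff_hasDerivAt {f : ℝ → ℝ} {w t : ℝ} :
    HasDirDeriv f w t 1 ↔ HasDerivAt f w t := by
  rw [hasDerivAt_iff_tendsto_slope_zero]
  simp [HasDirDeriv]

/-- The curve `s ↦ f (x + s • v)` has at `s` the derivative of `f` at `x + s • v`. -/
theorem hasDirDeriv_line_iff {f : E → F} {w : F} {x v : E} {s : ℝ} :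
    HasDirDeriv (fun r : ℝ => f (x + r • v)) w s 1 ↔ HasDirDeriv f w (x + s • v) v := by
  simp [HasDirDeriv, add_smul, add_assoc]

theorem HasDirDeriv.congr_of_eventuallyEq {f g : E → F} {w : F} {x v : E}
    (h : HasDirDeriv f w x v) (hx : g x = f x)
    (hfg : ∀ᶠ t in 𝓝 (0 : ℝ), g (x + t • v) = f (x + t • v)) : HasDirDeriv g w x v := by
  refine Tendsto.congr' ?_ h
  filter_upwards [hfg.filter_mono nhdsWithin_le_nhds] with t ht
  rw [ht, hx]

theorem hasDirDeriv_id [TopologicalSpace E] (x v : E) : HasDirDeriv (fun y : E => y) v x v := by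
  refine tendsto_const_nhds.congr' ?_
  filter_upwards [self_mem_nhdsWithin] with t ht
  rw [add_sub_cancel_left, inv_smul_smul₀ ht]

theorem hasDirDeriv_zero (f : E → F) (x : E) : HasDirDeriv f 0 x 0 := by
  simpa [HasDirDeriv] using tendsto_const_nhds

/-- Multiplying the difference quotient by `t` forces the increment to zero. Only continuity along
the line results, which is all the product rule needs. -/
theorem HasDirDeriv.continuousAt_line [IsTopologicalAddGroup F] [ContinuousSMul ℝ F]
    {f : E → F} {w : F} {x v : E} (h : HasDirDeriv f w x v) :
    Tendsto (fun t : ℝ => f (x + t • v)) (𝓝 0) (𝓝 (f x)) := by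
  have h1 : Tendsto (fun t : ℝ => f (x + t • v)) (𝓝[≠] 0) (𝓝 (f x)) := by
    have h2 : Tendsto (fun t : ℝ => t) (𝓝[≠] 0) (𝓝 0) :=
      tendsto_id.mono_left nhdsWithin_le_nhds
    have h3 := (h2.smul h).add (tendsto_const_nhds (x := f x))
    rw [zero_smul, zero_add] at h3
    refine h3.congr' ?_
    filter_upwards [self_mem_nhdsWithin] with t ht
    rw [smul_inv_smul₀ ht, sub_add_cancel]
  have h4 : ContinuousAt (fun t : ℝ => f (x + t • v)) 0 := by
    rw [continuousAt_iff_punctured_nhds]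
    simpa using h1
  simpa [ContinuousAt] using h4

theorem BSmoothOn.exists_deriv [TopologicalSpace E] {f : E → F} {U : Set E} (h : BSmoothOn f U) (hU : IsOpen U) :
    ∃ f' : E × E → F, (∀ x ∈ U, ∀ w, HasDirDeriv f (f' (x, w)) x w) ∧
      ∀ x ∈ U, ∀ w, ContinuousAt f' (x, w) := by
  obtain ⟨-, f', hf, hc⟩ := h 1
  exact ⟨f', hf, fun x hx w => ContinuousOn.continuousAt hc
    (prod_mem_nhds (hU.mem_nhds hx) univ_mem)⟩

theorem BSmoothOn.hasDirDeriv [TopologicalSpace E] [T2Space F] {f : E → F} {U : Set E} (h : BSmoothOn f U)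
    (hU : IsOpen U) {x : E} (hx : x ∈ U) (v : E) : HasDirDeriv f (dirDeriv f x v) x v := by
  obtain ⟨f', hf, -⟩ := h.exists_deriv hU
  rw [(hf x hx v).dirDeriv_eq]
  exact hf x hx v

/-- The product rule for a sequentially continuous bilinear map, along curves. -/
theorem HasDirDeriv.bilinear [TopologicalSpace E] [IsTopologicalAddGroup F]
    [ContinuousSMul ℝ F] {H : Type*} [AddCommGroup H] [Module ℝ H]
    (κ : E →ₗ[ℝ] F →ₗ[ℝ] ℝ) (hκ : SeqContinuous (fun q : E × F => κ q.1 q.2))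
    {a : H → E} {b : H → F} {a' : E} {b' : F} {x v : H}
    (ha : HasDirDeriv a a' x v) (hb : HasDirDeriv b b' x v) :
    HasDirDeriv (fun y => κ (a y) (b y)) (κ a' (b x) + κ (a x) b') x v := by
  -- The parameter is real, so limits can be tested on sequences, where sequential continuity of `κ`
  -- suffices. The quotient splits as `κ(Δa/t, b(x + tv)) + κ(a(x), Δb/t)`.
  refine tendsto_of_seq_tendsto fun u hu => ?_
  have hb0 := (hb.continuousAt_line.mono_left nhdsWithin_le_nhds).comp hu
  have h1 := hκ ((Tendsto.comp ha hu).prodMk_nhds hb0)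
  have h2 := hκ ((tendsto_const_nhds (x := a x)).prodMk_nhds (Tendsto.comp hb hu))
  refine (h1.add h2).congr fun n => ?_
  simp
  ring

/-- Mean value theorem: a difference lies in every closed convex set containing the
derivatives. -/
theorem sub_mem_of_forall_hasDirDeriv_mem [IsTopologicalAddGroup F] [ContinuousSMul ℝ F]
    [LocallyConvexSpace ℝ F] {φ φ' : ℝ → F} {N : Set F} (hN : Convex ℝ N) (hNc : IsClosed N)
    (hφ : ∀ s ∈ Icc (0 : ℝ) 1, HasDirDeriv φ (φ' s) s 1 ∧ φ' s ∈ N) : φ 1 - φ 0 ∈ N := by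
  by_contra hcon
  -- A functional separating the difference from `N` would contradict the scalar mean value theorem
  -- for `l ∘ φ`.
  obtain ⟨l, u, hl, hu⟩ := geometric_hahn_banach_closed_point hN hNc hcon
  have hd : ∀ s ∈ Icc (0 : ℝ) 1, HasDerivAt (fun r => l (φ r)) (l (φ' s)) s := by
    intro s hs
    rw [← hasDirDeriv_iff_hasDerivAt]
    refine ((l.continuous.tendsto _).comp (hφ s hs).1).congr fun t => ?_
    simp
  obtain ⟨c, hc, hc'⟩ := exists_hasDerivAt_eq_slope (fun r => l (φ r)) (fun r => l (φ' r))
    zero_lt_one (fun s hs => (hd s hs).continuousAt.continuousWithinAt)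
    (fun s hs => hd s (Ioo_subset_Icc_self hs))
  have h1 := hl _ (hφ c (Ioo_subset_Icc_self hc)).2
  have h2 : l (φ' c) = l (φ 1 - φ 0) := by simpa using hc'
  linarith

variable [TopologicalSpace E] [IsTopologicalAddGroup E] [ContinuousSMul ℝ E]
variable [IsTopologicalAddGroup F] [ContinuousSMul ℝ F] [LocallyConvexSpace ℝ F]

/-- A map with jointly continuous directional derivatives is strictly differentiable. -/
theorem tendsto_smul_sub_of_hasDirDeriv {f : E → F} {f' : E × E → F} {U : Set E} {x w : E}
    (hU : U ∈ 𝓝 x) (hf : ∀ y ∈ U, ∀ v, HasDirDeriv f (f' (y, v)) y v)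
    (hf' : ContinuousAt f' (x, w)) {y v : ℝ → E}
    (hy : Tendsto y (𝓝[≠] 0) (𝓝 x)) (hv : Tendsto v (𝓝[≠] 0) (𝓝 w)) :
    Tendsto (fun t : ℝ => t⁻¹ • (f (y t + t • v t) - f (y t))) (𝓝[≠] 0) (𝓝 (f' (x, w))) := by
  rw [((LocallyConvexSpace.convex_basis (𝕜 := ℝ) (f' (x, w)))).tendsto_right_iff]
  rintro N₀ ⟨hN₀, hN₀c⟩
  -- The mean value lemma needs a neighbourhood that is both closed and convex: the closure of a
  -- convex one inside a closed one.
  obtain ⟨N₁, hN₁, hN₁c, hN₁s⟩ := exists_mem_nhds_isClosed_subset hN₀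
  obtain ⟨N₂, ⟨hN₂, hN₂c⟩, hN₂s⟩ :=
    ((LocallyConvexSpace.convex_basis (𝕜 := ℝ) (f' (x, w)))).mem_iff.1 hN₁
  have hNs : closure N₂ ⊆ N₀ := (closure_minimal hN₂s hN₁c).trans hN₁s
  have hg : ContinuousAt (fun q : ℝ × E × E => (q.2.1 + q.1 • q.2.2, q.2.2))
      ((0 : ℝ), x, w) := by fun_prop
  have hmem : U ×ˢ univ ∩ f' ⁻¹' (closure N₂) ∈ 𝓝 (x + (0 : ℝ) • w, w) := by
    rw [zero_smul, add_zero]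
    exact inter_mem (prod_mem_nhds hU univ_mem)
      (hf' (mem_of_superset hN₂ subset_closure))
  have hpre := hg.preimage_mem_nhds hmem
  rw [nhds_prod_eq, mem_prod_iff] at hpre
  obtain ⟨S, hS, T, hT, hST⟩ := hpre
  obtain ⟨δ, hδ, hδS⟩ := Metric.mem_nhds_iff.1 hS
  have hyv : ∀ᶠ t in 𝓝[≠] (0 : ℝ), (y t, v t) ∈ T := (hy.prodMk_nhds hv) hT
  have hδt : ∀ᶠ t in 𝓝[≠] (0 : ℝ), |t| < δ := by
    refine nhdsWithin_le_nhds (mem_of_superset (Metric.ball_mem_nhds 0 hδ) fun t ht => ?_)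
    simpa using ht
  filter_upwards [hyv, hδt, self_mem_nhdsWithin] with t ht htδ ht0
  have ht0 : t ≠ 0 := ht0
  -- The factor `t⁻¹` cancels the speed of the segment, so the derivative is `f'` in the unscaled
  -- direction `v t`, where continuity of `f'` at `(x, w)` applies.
  have key := sub_mem_of_forall_hasDirDeriv_mem (φ := fun s => t⁻¹ • f (y t + s • t • v t))
    (φ' := fun s => f' (y t + (s * t) • v t, v t)) hN₂c.closure isClosed_closure ?_
  · apply hNs
    simpa [smul_sub] using key
  · intro s hs
    have hst : s * t ∈ S := by
      apply hδS
      rw [mem_ball_zero_iff, Real.norm_eq_abs, abs_mul, abs_of_nonneg hs.1]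
      exact (mul_le_of_le_one_left (abs_nonneg t) hs.2).trans_lt htδ
    have hq := hST (mk_mem_prod hst ht)
    have hqU : y t + (s * t) • v t ∈ U := hq.1.1
    refine ⟨?_, hq.2⟩
    -- Reparametrizing the increment by `t` replaces any appeal to homogeneity of `f'` in its
    -- direction.
    have hlim : Tendsto (fun h : ℝ => h * t) (𝓝[≠] 0) (𝓝[≠] 0) := by
      refine tendsto_nhdsWithin_iff.2 ⟨?_, ?_⟩
      · have : Tendsto (fun h : ℝ => h * t) (𝓝 0) (𝓝 (0 * t)) :=
          (continuous_id.mul continuous_const).tendsto 0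
        rw [zero_mul] at this
        exact this.mono_left nhdsWithin_le_nhds
      · filter_upwards [self_mem_nhdsWithin] with h hh
        exact mul_ne_zero hh ht0
    refine ((hf _ hqU (v t)).comp hlim).congr fun h => ?_
    simp only [Function.comp_apply, smul_eq_mul, mul_one, add_mul, add_smul, smul_smul, mul_inv, smul_sub,
      add_assoc]

/-- The chain rule for directional derivatives. -/
theorem HasDirDeriv.comp {H : Type*} [AddCommGroup H] [Module ℝ H] {g : H → E} {w : E} {h v : H}
    (hg : HasDirDeriv g w h v) {f : E → F} {f' : E × E → F} {U : Set E} (hU : U ∈ 𝓝 (g h))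
    (hf : ∀ y ∈ U, ∀ v, HasDirDeriv f (f' (y, v)) y v) (hf' : ContinuousAt f' (g h, w)) :
    HasDirDeriv (fun z => f (g z)) (f' (g h, w)) h v := by
  -- Fixed base point `g h`; the moving direction is the difference quotient of `g`.
  refine (tendsto_smul_sub_of_hasDirDeriv hU hf hf' tendsto_const_nhds hg).congr' ?_
  filter_upwards [self_mem_nhdsWithin] with t ht
  rw [smul_inv_smul₀ ht, add_sub_cancel]

/-- Additivity of the derivative in the direction. -/
theorem deriv_add_of_hasDirDeriv [T2Space F] {f : E → F} {f' : E × E → F} {U : Set E} {x a b : E}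
    (hU : U ∈ 𝓝 x) (hf : ∀ y ∈ U, ∀ v, HasDirDeriv f (f' (y, v)) y v)
    (hf' : ContinuousAt f' (x, b)) : f' (x, a + b) = f' (x, a) + f' (x, b) := by
  have hx := mem_of_mem_nhds hU
  have hy : Tendsto (fun t : ℝ => x + t • a) (𝓝[≠] 0) (𝓝 x) := by
    have : Tendsto (fun t : ℝ => x + t • a) (𝓝 0) (𝓝 (x + (0 : ℝ) • a)) :=
      Continuous.tendsto (by fun_prop) 0
    rw [zero_smul, add_zero] at this
    exact this.mono_left nhdsWithin_le_nhds
  -- Travel from `x` to `x + ta`, then on to `x + ta + tb`; the second leg has a moving base point.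
  have h1 := (hf x hx a).add
    (tendsto_smul_sub_of_hasDirDeriv hU hf hf' hy (tendsto_const_nhds (x := b)))
  refine tendsto_nhds_unique (hf x hx (a + b)) (h1.congr fun t => ?_)
  rw [← smul_add, smul_add t, add_assoc x]
  congr 1
  abel

theorem BSmoothOn.hasDirDeriv_comp [T2Space F] {f : E → F} {U : Set E} (h : BSmoothOn f U)
    (hU : IsOpen U) {H : Type*} [AddCommGroup H] [Module ℝ H] {g : H → E} {w : E} {z v : H}
    (hg : HasDirDeriv g w z v) (hz : g z ∈ U) :
    HasDirDeriv (fun y => f (g y)) (dirDeriv f (g z) w) z v := by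
  obtain ⟨f', hf, hc⟩ := h.exists_deriv hU
  rw [(hf _ hz w).dirDeriv_eq]
  exact hg.comp (hU.mem_nhds hz) hf (hc _ hz w)

theorem BSmoothOn.dirDeriv_add [T2Space F] {f : E → F} {U : Set E} (h : BSmoothOn f U)
    (hU : IsOpen U) {x : E} (hx : x ∈ U) (a b : E) :
    dirDeriv f x (a + b) = dirDeriv f x a + dirDeriv f x b := by
  obtain ⟨f', hf, hc⟩ := h.exists_deriv hU
  rw [(hf x hx _).dirDeriv_eq, (hf x hx _).dirDeriv_eq, (hf x hx _).dirDeriv_eq]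
  exact deriv_add_of_hasDirDeriv (hU.mem_nhds hx) hf (hc x hx b)

end LocallyConvexCalculus

end CartanGIT

namespace CartanGIT

/-! ### Velocities of curves in manifolds. -/

section Curves

variable (E : Type*) [AddCommGroup E] [Module ℝ E] [TopologicalSpace E]
variable {M : Type*} [TopologicalSpace M] [ChartedSpace E M]

/-- The curve `c` in a manifold has velocity `X` at time `t`. -/
def HasVelocity (c : ℝ → M) (t : ℝ) (X : TangentAt E (c t)) : Prop :=
  ContinuousAt c t ∧ HasDirDeriv (fun r => chartAt E (c t) (c r)) X t 1

variable {E}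

theorem eventually_line {x v : E} [ContinuousAdd E] [ContinuousSMul ℝ E] {p : E → Prop}
    (h : ∀ᶠ y in 𝓝 x, p y) : ∀ᶠ t in 𝓝 (0 : ℝ), p (x + t • v) := by
  have : Tendsto (fun t : ℝ => x + t • v) (𝓝 0) (𝓝 (x + (0 : ℝ) • v)) :=
    Continuous.tendsto (by fun_prop) 0
  rw [zero_smul, add_zero] at this
  exact this h

/-- A function which locally factors through the chart at `c t` can be differentiated
along `c` in that chart. -/
theorem HasVelocity.hasDirDeriv_of_chart [IsTopologicalAddGroup E] [ContinuousSMul ℝ E]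
    {F : Type*} [AddCommGroup F] [Module ℝ F] [TopologicalSpace F] [IsLCS F]
    {c : ℝ → M} {t : ℝ} {X : TangentAt E (c t)} (hc : HasVelocity E c t X) {f : M → F}
    {h : E → F} {W : Set E} (hh : BSmoothOn h W) (hW : IsOpen W)
    (htW : chartAt E (c t) (c t) ∈ W)
    (hfh : ∀ y ∈ (chartAt E (c t)).source, f y = h (chartAt E (c t) y)) :
    HasDirDeriv (fun r => f (c r)) (dirDeriv h (chartAt E (c t) (c t)) X) t 1 := by
  refine (hh.hasDirDeriv_comp hW hc.2 htW).congr_of_eventuallyEq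
    (hfh _ (mem_chart_source E (c t))) ?_
  refine eventually_line (p := fun r => f (c r) = h (chartAt E (c t) (c r))) ?_
  filter_upwards [hc.1 ((chartAt E (c t)).open_source.mem_nhds (mem_chart_source E (c t)))]
    with r hr
  exact hfh _ hr

/-- The chain rule on manifolds: velocities at `c t` and `f (c t)` are read in exactly the preferred
charts that define `localRep`, so no change of chart intervenes. -/
theorem SmoothMapOn.hasVelocity_comp [IsTopologicalAddGroup E] [ContinuousSMul ℝ E]
    {F : Type*} [AddCommGroup F] [Module ℝ F] [TopologicalSpace F] [IsLCS F]
    {N : Type*} [TopologicalSpace N] [ChartedSpace F N] {f : M → N} {U : Set M}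
    (hf : SmoothMapOn E F f U) (hU : IsOpen U) {c : ℝ → M} {t : ℝ} {X : TangentAt E (c t)}
    (hc : HasVelocity E c t X) (ht : c t ∈ U) :
    HasVelocity F (fun r => f (c r)) t (tangentMap E F f (c t) X) := by
  have hfc : ContinuousAt f (c t) := hf.1.continuousAt (hU.mem_nhds ht)
  refine ⟨hfc.comp hc.1, ?_⟩
  have hO : IsOpen (U ∩ f ⁻¹' (chartAt F (f (c t))).source) :=
    hf.1.isOpen_inter_preimage hU (chartAt F (f (c t))).open_source
  have hW := (chartAt E (c t)).isOpen_inter_preimage_symm hO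
  have hx : chartAt E (c t) (c t) ∈ (chartAt E (c t)).target ∩
      (chartAt E (c t)).symm ⁻¹' (U ∩ f ⁻¹' (chartAt F (f (c t))).source) := by
    refine ⟨mem_chart_target E (c t), ?_⟩
    rw [mem_preimage, (chartAt E (c t)).left_inv (mem_chart_source E (c t))]
    exact ⟨ht, mem_chart_source F (f (c t))⟩
  refine hc.hasDirDeriv_of_chart (f := fun y => chartAt F (f (c t)) (f y)) (hf.2 _ ht) hW hx ?_
  intro y hy
  simp only [localRep]
  rw [(chartAt E (c t)).left_inv hy]

theorem SmoothMap.hasVelocity_comp [IsTopologicalAddGroup E] [ContinuousSMul ℝ E]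
    {F : Type*} [AddCommGroup F] [Module ℝ F] [TopologicalSpace F] [IsLCS F]
    {N : Type*} [TopologicalSpace N] [ChartedSpace F N] {f : M → N}
    (hf : SmoothMap E F f) {c : ℝ → M} {t : ℝ} {X : TangentAt E (c t)}
    (hc : HasVelocity E c t X) :
    HasVelocity F (fun r => f (c r)) t (tangentMap E F f (c t) X) :=
  SmoothMapOn.hasVelocity_comp hf isOpen_univ hc (mem_univ _)

/-- The preferred chart at the point reached need not be `φ`, so the velocity is `v` transported by
the derivative of the transition map. Its value is irrelevant for the later use. -/
theorem hasVelocity_chart_line [IsLCS E] [LCManifold E M] {φ : OpenPartialHomeomorph M E}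
    (hφ : φ ∈ atlas E M) {x v : E} {t : ℝ} (ht : x + t • v ∈ φ.target) :
    ∃ X : E, HasVelocity E (fun r : ℝ => φ.symm (x + r • v)) t X := by
  have h := (LCManifold.smooth_transition φ hφ _
    (chart_mem_atlas E (φ.symm (x + t • v)))).hasDirDeriv
    (φ.isOpen_inter_preimage_symm (chartAt E (φ.symm (x + t • v))).open_source)
    ⟨ht, mem_chart_source E _⟩ v
  have hl : ContinuousAt (fun r : ℝ => x + r • v) t := by fun_prop
  have hs : ContinuousAt (fun r : ℝ => φ.symm (x + r • v)) t :=
    ContinuousAt.comp (f := fun r : ℝ => x + r • v) (φ.continuousAt_symm ht) hl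
  exact ⟨_, hs, hasDirDeriv_line_iff
    (f := fun u => chartAt E (φ.symm (x + t • v)) (φ.symm u)).2 h⟩

theorem HasVelocity.const_prodMk {E₁ : Type*} [AddCommGroup E₁] [Module ℝ E₁]
    [TopologicalSpace E₁] {M₁ : Type*} [TopologicalSpace M₁] [ChartedSpace E₁ M₁] (g : M₁)
    {c : ℝ → M} {t : ℝ} {X : TangentAt E (c t)} (hc : HasVelocity E c t X) :
    letI : ChartedSpace (E₁ × E) (M₁ × M) := prodChartedSpace E₁ M₁ E M
    HasVelocity (E₁ × E) (fun r => (g, c r)) t ((0, X) : E₁ × E) := by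
  refine ⟨continuousAt_const.prodMk hc.1, ?_⟩
  have h1 : Tendsto (fun r : ℝ => r⁻¹ • (chartAt E₁ g g - chartAt E₁ g g)) (𝓝[≠] 0) (𝓝 0) := by
    simpa using tendsto_const_nhds
  exact h1.prodMk_nhds hc.2

end Curves

/-! ### Forms and vector fields in charts; Cartan's formula along curves. -/

section Forms

variable {E : Type*} [AddCommGroup E] [Module ℝ E] [TopologicalSpace E] [IsLCS E]
variable {M : Type*} [TopologicalSpace M] [ChartedSpace E M] [LCManifold E M]

/-- The two transition maps between the preferred charts at `x` and at the given point are mutually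
inverse there; apply the chain rule to their composite. -/
theorem fromChart_toChart (x : M) {u : E} (hu : u ∈ (chartAt E x).target)
    (Y : E) :
    fromChart E x u (toChart E x ((chartAt E x).symm u) Y) = Y := by
  set q := (chartAt E x).symm u with hq
  have hqx : q ∈ (chartAt E x).source := (chartAt E x).map_target hu
  have hqq := mem_chart_source E q
  have hxq : chartAt E x q = u := (chartAt E x).right_inv hu
  have hz : (chartAt E x) ((chartAt E q).symm (chartAt E q q)) = u := by
    rw [(chartAt E q).left_inv hqq, hxq]
  have hmem : chartAt E q q ∈ (chartAt E q).target ∩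
      (chartAt E q).symm ⁻¹' (chartAt E x).source := by
    refine ⟨mem_chart_target E q, ?_⟩
    rwa [mem_preimage, (chartAt E q).left_inv hqq]
  have hO := (chartAt E q).isOpen_inter_preimage_symm (chartAt E x).open_source
  have h1 := (LCManifold.smooth_transition _ (chart_mem_atlas E q) _
    (chart_mem_atlas E x)).hasDirDeriv hO hmem Y
  have h2 := (LCManifold.smooth_transition _ (chart_mem_atlas E x) _
    (chart_mem_atlas E q)).hasDirDeriv_comp
      ((chartAt E x).isOpen_inter_preimage_symm (chartAt E q).open_source) h1
      (by rw [hz]; exact ⟨hu, hqq⟩)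
  rw [hz] at h2
  have hid : ∀ y ∈ (chartAt E q).target ∩ (chartAt E q).symm ⁻¹' (chartAt E x).source,
      chartAt E q ((chartAt E x).symm (chartAt E x ((chartAt E q).symm y))) = y := by
    rintro y ⟨hy, hy'⟩
    rw [(chartAt E x).left_inv hy', (chartAt E q).right_inv hy]
  have h3 : HasDirDeriv (fun y : E => y) _ (chartAt E q q) Y :=
    h2.congr_of_eventuallyEq (hid _ hmem).symm (eventually_line (p := fun y =>
      y = chartAt E q ((chartAt E x).symm (chartAt E x ((chartAt E q).symm y)))) (by
      filter_upwards [hO.mem_nhds hmem] with y hy using (hid y hy).symm))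
  exact tendsto_nhds_unique h3 (hasDirDeriv_id _ _)

omit [LCManifold E M] in
theorem dirDeriv_chart_symm (x : M) (w : E) :
    dirDeriv (fun u : E => chartAt E x ((chartAt E x).symm u)) (chartAt E x x) w = w := by
  refine HasDirDeriv.dirDeriv_eq ((hasDirDeriv_id _ w).congr_of_eventuallyEq
    ((chartAt E x).right_inv (mem_chart_target E x)) (eventually_line
      (p := fun y => chartAt E x ((chartAt E x).symm y) = y) ?_))
  filter_upwards [(chartAt E x).open_target.mem_nhds (mem_chart_target E x)] with y hy
  exact (chartAt E x).right_inv hy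

omit [LCManifold E M] in
theorem fromChart_self (x : M) (w : E) : fromChart E x (chartAt E x x) w = w := by
  unfold fromChart
  rw [(chartAt E x).left_inv (mem_chart_source E x)]
  exact dirDeriv_chart_symm x w

variable {V : Type*} [AddCommGroup V] [Module ℝ V] [TopologicalSpace V]

omit [LCManifold E M] in
theorem localForm_self (θ : ∀ p : M, TangentAt E p →L[ℝ] V) (x : M) (w : E) :
    localForm E θ x (chartAt E x x) w = θ x w := by
  unfold localForm
  rw [fromChart_self]
  rw [(chartAt E x).left_inv (mem_chart_source E x)]

/-- The pairing of a form with a field does not depend on the chart. This allows `θ(Z)` to be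
differentiated in one fixed chart although the identification of tangent spaces varies with the
point. -/
theorem localForm_localField (θ : ∀ p : M, TangentAt E p →L[ℝ] V)
    (Z : ∀ p : M, TangentAt E p) (x : M) {y : M} (hy : y ∈ (chartAt E x).source) :
    localForm E θ x (chartAt E x y) (localField E Z x (chartAt E x y)) = θ y (Z y) := by
  unfold localForm localField
  rw [fromChart_toChart x ((chartAt E x).map_source hy)]
  exact congrArg (fun q => θ q (Z q)) ((chartAt E x).left_inv hy)

omit [LCManifold E M] in
theorem localField_self (Z : ∀ p : M, TangentAt E p) (x : M) :
    localField E Z x (chartAt E x x) = Z x := by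
  have hx := (chartAt E x).left_inv (mem_chart_source E x)
  exact (congrArg (fun q => toChart E x q (Z q)) hx).trans (dirDeriv_chart_symm x (Z x))

/-- The derivative of `θ(Z)` along a curve with velocity `X` is `dθ(X, Z) + (L_Z θ)(X)`. -/
theorem HasVelocity.hasDirDeriv_form [IsLCS V] {θ : ∀ p : M, TangentAt E p →L[ℝ] V}
    (hθ : IsSmoothForm E θ) {Z : ∀ p : M, TangentAt E p} (hZ : IsSmoothField E Z)
    {c : ℝ → M} {t : ℝ} {X : E} (hc : HasVelocity E c t X) :
    HasDirDeriv (fun r => θ (c r) (Z (c r)))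
      (extDerivForm E θ (c t) X (Z (c t)) + lieDerivForm E Z θ (c t) X) t 1 := by
  set p := c t with hp
  set u := chartAt E p p with hu
  have hut : u ∈ (chartAt E p).target := mem_chart_target E p
  have hZu : localField E Z p u = Z p := localField_self Z p
  have hop : IsOpen ((chartAt E p).target ×ˢ (univ : Set E)) :=
    (chartAt E p).open_target.prod isOpen_univ
  have hmem : (u, Z p) ∈ (chartAt E p).target ×ˢ (univ : Set E) := ⟨hut, mem_univ _⟩
  have hfield : HasDirDeriv (fun r => localField E Z p (chartAt E p (c r)))
      (dirDeriv (localField E Z p) u X) t 1 :=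
    (hZ p).hasDirDeriv_comp (chartAt E p).open_target hc.2 hut
  set Y := dirDeriv (localField E Z p) u X with hY
  have hpair : HasDirDeriv
      (fun r => (chartAt E p (c r), localField E Z p (chartAt E p (c r)))) (X, Y) t 1 :=
    Tendsto.prodMk_nhds hc.2 hfield
  have hcomp := (hθ p).hasDirDeriv_comp hop hpair ⟨hut, mem_univ _⟩
  -- Splits into partial derivatives: the first differentiates the coefficients of `θ`; the second,
  -- by linearity of `θ p`, is `θ p Y`.
  have hsplit := (hθ p).dirDeriv_add hop hmem (X, 0) (0, Y)
  have hX : dirDeriv (fun q : E × E => localForm E θ p q.1 q.2) (u, Z p) (X, 0) =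
      dirDeriv (fun u => localForm E θ p u (Z p)) u X := by
    simp [dirDeriv]
  have hY' : dirDeriv (fun q : E × E => localForm E θ p q.1 q.2) (u, Z p) (0, Y) = θ p Y := by
    refine HasDirDeriv.dirDeriv_eq (tendsto_const_nhds.congr' ?_)
    filter_upwards [self_mem_nhdsWithin] with r hr
    simp only [Prod.smul_mk, Prod.mk_add_mk, smul_zero, add_zero]
    rw [localForm_self, localForm_self, map_add, add_sub_cancel_left, map_smul,
      inv_smul_smul₀ hr]
  have hval : dirDeriv (fun q : E × E => localForm E θ p q.1 q.2)
      (chartAt E p (c t), localField E Z p (chartAt E p (c t))) (X, Y) =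
      extDerivForm E θ p X (Z p) + lieDerivForm E Z θ p X := by
    rw [← hp, ← hu, hZu]
    -- The term `D_Z θ(X)` enters `dθ(X, Z)` and `(L_Z θ)(X)` with opposite signs and cancels.
    have : ((X, Y) : E × E) = (X, 0) + (0, Y) := by simp
    rw [this, hsplit, hX, hY']
    simp only [extDerivForm, lieDerivForm]
    abel
  rw [hval] at hcomp
  refine HasDirDeriv.congr_of_eventuallyEq hcomp
    (localForm_localField θ Z p (mem_chart_source E p)).symm ?_
  refine eventually_line (p := fun r => θ (c r) (Z (c r)) =
    localForm E θ p (chartAt E p (c r)) (localField E Z p (chartAt E p (c r)))) ?_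
  filter_upwards [hc.1 ((chartAt E p).open_source.mem_nhds (mem_chart_source E p))] with r hr
  exact (localForm_localField θ Z p hr).symm

end Forms

end CartanGIT

namespace CartanGIT

theorem tangentMap_zero {E : Type*} [AddCommGroup E] [Module ℝ E] [TopologicalSpace E]
    {F : Type*} [AddCommGroup F] [Module ℝ F] [TopologicalSpace F] [T2Space F]
    {M : Type*} [TopologicalSpace M] [ChartedSpace E M]
    {N : Type*} [TopologicalSpace N] [ChartedSpace F N] (f : M → N) (x : M) :
    tangentMap E F f x (0 : E) = (0 : F) :=
  (hasDirDeriv_zero _ _).dirDeriv_eq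

/-! ### Fibres of the principal bundle and functions on its base. -/

section Bundle

variable {EG : Type*} [AddCommGroup EG] [Module ℝ EG] [TopologicalSpace EG]
variable {G : Type*} [Group G] [TopologicalSpace G] [ChartedSpace EG G]
variable {EP : Type*} [AddCommGroup EP] [Module ℝ EP] [TopologicalSpace EP]
variable {P : Type*} [TopologicalSpace P] [ChartedSpace EP P] [MulAction G P]
variable {EB : Type*} [AddCommGroup EB] [Module ℝ EB] [TopologicalSpace EB]
variable {B : Type*} [TopologicalSpace B] [ChartedSpace EB B] {π : P → B}

theorem IsPrincipalBundle.surjective (h : IsPrincipalBundle EG G EP EB π) :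
    Function.Surjective π := by
  intro b
  obtain ⟨U, -, hb, τ, s, -, -, -, hs, -⟩ := h.locally_trivial b
  exact ⟨s (1, b), (hs 1 b hb).1⟩

/-- In a local trivialization a point is determined by its `G`-coordinate `τ` and its base point;
left translation by `τ q * (τ p)⁻¹` matches the `G`-coordinates. -/
theorem IsPrincipalBundle.exists_smul_eq (h : IsPrincipalBundle EG G EP EB π) {p q : P}
    (hpq : π p = π q) : ∃ g : G, g • p = q := by
  obtain ⟨U, -, hb, τ, s, -, -, hτ, -, hs⟩ := h.locally_trivial (π p)
  refine ⟨τ q * (τ p)⁻¹, ?_⟩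
  have hq : π q ∈ U := hpq ▸ hb
  have hp := hs ((τ q * (τ p)⁻¹) • p) (by rwa [h.proj_smul])
  rw [h.proj_smul, hτ _ _ hb, hpq, inv_mul_cancel_right] at hp
  exact hp.symm.trans (hs q hq)

/-- A function on the base whose pull-back to the total space has vanishing derivative along all
curves is locally constant. -/
theorem IsPrincipalBundle.isLocallyConstant [IsLCS EG] [IsLCS EP] [IsLCS EB] [LCManifold EB B]
    (h : IsPrincipalBundle EG G EP EB π) {F : B → ℝ}
    (hF : ∀ (c : ℝ → P) (t : ℝ) (X : EP), HasVelocity EP c t X →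
      HasDirDeriv (fun r => F (π (c r))) 0 t 1) : IsLocallyConstant F := by
  rw [IsLocallyConstant.iff_eventually_eq]
  intro b
  obtain ⟨U, hU, hb, τ, s, -, hs, -, hπs, -⟩ := h.locally_trivial b
  let φ := chartAt EB b
  have hO : IsOpen (φ.target ∩ φ.symm ⁻¹' U) := φ.isOpen_inter_preimage_symm hU
  have hbs : b ∈ φ.source := mem_chart_source EB b
  have hbO : φ b ∈ φ.target ∩ φ.symm ⁻¹' U := by
    refine ⟨φ.map_source hbs, ?_⟩
    rwa [mem_preimage, φ.left_inv hbs]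
  -- Convexity keeps the whole chart segment from `b` to a nearby `b'` inside the trivializing set.
  obtain ⟨V, ⟨hV, hVc⟩, hVO⟩ :=
    (LocallyConvexSpace.convex_basis (𝕜 := ℝ) (φ b)).mem_iff.1 (hO.mem_nhds hbO)
  have hVi : φ b ∈ V := mem_of_mem_nhds hV
  filter_upwards [φ.open_source.mem_nhds hbs, (φ.continuousAt hbs) hV] with b' hb' hb'V
  set v := φ b' - φ b with hv
  have hline : ∀ t ∈ Icc (0 : ℝ) 1, φ b + t • v ∈ φ.target ∩ φ.symm ⁻¹' U := fun t ht =>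
    hVO (hVc.add_smul_sub_mem hVi hb'V ht)
  have hder : ∀ t ∈ Icc (0 : ℝ) 1,
      HasDerivAt (fun r : ℝ => F (φ.symm (φ b + r • v))) 0 t := by
    intro t ht
    obtain ⟨Y, hY⟩ := hasVelocity_chart_line (M := B) (chart_mem_atlas EB b) (hline t ht).1
    let _ : ChartedSpace (EG × EB) (G × B) := prodChartedSpace EG G EB B
    have hs' : SmoothMapOn (EG × EB) EP s (univ ×ˢ U) := hs
    -- The local section `s (1, ·)` lifts the segment to a curve in the total space, where `hF`
    -- applies.
    have hc := SmoothMapOn.hasVelocity_comp hs' (isOpen_univ.prod hU)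
      (hY.const_prodMk (E₁ := EG) (1 : G)) ⟨mem_univ _, (hline t ht).2⟩
    rw [← hasDirDeriv_iff_hasDerivAt]
    refine (hF _ t _ hc).congr_of_eventuallyEq ?_ ?_
    · exact congrArg F (hπs 1 _ (hline t ht).2).1.symm
    · refine eventually_line (p := fun r => F (φ.symm (φ b + r • v)) =
        F (π (s (1, φ.symm (φ b + r • v))))) ?_
      filter_upwards [hY.1 (hU.mem_nhds (hline t ht).2)] with r hr
      exact congrArg F (hπs 1 _ hr).1.symm
  have hconst := constant_of_has_deriv_right_zero
    (fun t ht => (hder t ht).continuousAt.continuousWithinAt)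
    (fun t ht => (hder t (Ico_subset_Icc_self ht)).hasDerivWithinAt) 1 ⟨zero_le_one, le_rfl⟩
  simpa [hv, φ.left_inv hb', φ.left_inv hbs] using hconst

end Bundle

/-! ### Invariance and vanishing derivative of the lifted function. -/

section Futaki

variable {EG : Type*} [AddCommGroup EG] [Module ℝ EG] [TopologicalSpace EG]
variable {G : Type*} [Group G] [TopologicalSpace G] [ChartedSpace EG G]
variable {A : Type*} [LieRing A] [LieAlgebra ℝ A] [TopologicalSpace A]
variable {K : KleinPair EG G A}
variable {EP : Type*} [AddCommGroup EP] [Module ℝ EP] [TopologicalSpace EP]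
variable {P : Type*} [TopologicalSpace P] [ChartedSpace EP P] [MulAction G P]
variable {EB : Type*} [AddCommGroup EB] [Module ℝ EB] [TopologicalSpace EB]
variable {B : Type*} [TopologicalSpace B] [ChartedSpace EB B]
variable {EM : Type*} [AddCommGroup EM] [Module ℝ EM] [TopologicalSpace EM]
variable {M : Type*} [TopologicalSpace M] [ChartedSpace EM M] [MulAction G M]
variable {D : Type*} [AddCommGroup D] [Module ℝ D] [TopologicalSpace D]
variable {C : CartanGeometry K EP P EB B} {m : M} {O : OrbitModel EM C m}
variable {k : LieDuality EG G D} {ka : KleinDuality K k} {J : M → D}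

/-- By antisymmetry of the bracket, the wedge is twice the bracket, which absorbs the factor `1 /
2`. -/
theorem CartanGeometry.curvature_eq (C : CartanGeometry K EP P EB B) (p : P)
    (X Y : TangentAt EP p) :
    C.curvature p X Y = extDerivForm EP C.form p X Y - ⁅C.θ p X, C.θ p Y⁆ := by
  have h : wedgeLie C.form C.form p X Y = (2 : ℝ) • ⁅C.θ p X, C.θ p Y⁆ := by
    rw [two_smul, wedgeLie, ← lie_skew (C.form p Y), sub_neg_eq_add]
    rfl
  rw [curvature, h, smul_smul]
  norm_num

theorem futakiLift_smul (hJa : IsAEquivariant O ka J) (ζ : O.stab) (g : G) (p : P) :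
    futakiLift O ka J ζ (g • p) = futakiLift O ka J ζ p := by
  -- The test vector `Ad_g θ_p(ζ*)` is the value of `θ(ζ*)` at `g • p`, by equivariance of `θ` and
  -- commutation of the actions.
  have h := hJa.cocycle g (O.χ p) (K.Ad g (C.θ p (O.act ζ p)))
  rw [nonequivarianceCocycle, map_sub, LinearMap.sub_apply, ka.invariant, sub_eq_zero] at h
  rw [futakiLift, O.equivariant, ← O.act_commutes, C.equivariant]
  exact h

/-- The product rule leaves a variation of `J` and a variation of `θ(ζ*)`. Modulo `𝔤` these are
opposite pairings of `J` with the same bracket. -/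
theorem HasVelocity.futakiLift [IsLCS EM] [IsLCS A] [IsLCS D] [IsLCS EP] [LCManifold EP P]
    (hJ : SmoothMap EM D J) (hJa : IsAEquivariant O ka J) (hC : C.TorsionFree) {ζ : O.stab}
    (hζ : ∀ (p : P) (X : TangentAt EP p), lieDerivForm EP (O.act ζ) C.form p X ∈ K.sub)
    {c : ℝ → P} {t : ℝ} {X : EP} (hc : HasVelocity EP c t X) :
    HasDirDeriv (fun r => futakiLift O ka J ζ (c r)) 0 t 1 := by
  have hj := (SmoothMap.hasVelocity_comp hJ (SmoothMap.hasVelocity_comp O.smooth hc)).2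
  have hf := hc.hasDirDeriv_form (θ := C.form) C.smooth (O.smooth_act ζ)
  have h := HasDirDeriv.bilinear ka.κ ka.seqContinuous hj hf
  have hcal := hJa.calabi_comm (c t) (C.θ (c t) X) (C.θ (c t) (O.act ζ (c t)))
  have hX : calabi O J (c t) (C.θ (c t) X) =
      tangentMap EM D J (O.χ (c t)) (tangentMap EP EM O.χ (c t) X) := by
    rw [calabi, OrbitModel.infAction, ContinuousLinearEquiv.symm_apply_apply]
  -- `ζ*` is tangent to the fibres of `χ` infinitesimally, which kills one of the two Calabi terms.
  have hZ : calabi O J (c t) (C.θ (c t) (O.act ζ (c t))) = 0 := by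
    rw [calabi, OrbitModel.infAction, ContinuousLinearEquiv.symm_apply_apply, O.tangent_act]
    exact tangentMap_zero J _
  -- Under `κ_𝔞`, torsion-freeness identifies `dθ(X, ζ*)` with the bracket.
  have hcurv := ka.vanishes (J (O.χ (c t))) _ (hC (c t) X (O.act ζ (c t)))
  rw [C.curvature_eq, map_sub, sub_eq_zero] at hcurv
  have hlie := ka.vanishes (J (O.χ (c t))) _ (hζ (c t) X)
  rw [hX, hZ, map_zero, LinearMap.zero_apply, sub_zero] at hcal
  have hzero : ka.κ (tangentMap EM D J (O.χ (c t)) (tangentMap EP EM O.χ (c t) X))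
      (C.form (c t) (O.act ζ (c t))) + ka.κ (J (O.χ (c t)))
        (extDerivForm EP C.form (c t) X (O.act ζ (c t)) +
          lieDerivForm EP (O.act ζ) C.form (c t) X) = 0 := by
    rw [map_add, hlie, hcurv, add_zero]
    exact (congrArg (· + _) hcal).trans (neg_add_cancel _)
  exact hzero ▸ h

end Futaki

end CartanGIT

/-! ### Descent to the base and local constancy. -/

theorem mainTheorem1
    {EM : Type*} [AddCommGroup EM] [Module ℝ EM] [TopologicalSpace EM] [CartanGIT.IsLCS EM]
    {M : Type*} [TopologicalSpace M] [ChartedSpace EM M] [CartanGIT.LCManifold EM M]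
    {EG : Type*} [AddCommGroup EG] [Module ℝ EG] [TopologicalSpace EG] [CartanGIT.IsLCS EG]
    {G : Type*} [Group G] [TopologicalSpace G] [ChartedSpace EG G] [CartanGIT.LCLieGroup EG G]
    {A : Type*} [LieRing A] [LieAlgebra ℝ A] [TopologicalSpace A] [CartanGIT.IsLCS A]
    {D : Type*} [AddCommGroup D] [Module ℝ D] [TopologicalSpace D] [CartanGIT.IsLCS D]
    {EP : Type*} [AddCommGroup EP] [Module ℝ EP] [TopologicalSpace EP] [CartanGIT.IsLCS EP]
    {P : Type*} [TopologicalSpace P] [ChartedSpace EP P] [CartanGIT.LCManifold EP P]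
    {EB : Type*} [AddCommGroup EB] [Module ℝ EB] [TopologicalSpace EB] [CartanGIT.IsLCS EB]
    {B : Type*} [TopologicalSpace B] [ChartedSpace EB B] [CartanGIT.LCManifold EB B]
    [MulAction G M] [MulAction G P]
    (ω : ∀ x : M, CartanGIT.TangentAt EM x →ₗ[ℝ] CartanGIT.TangentAt EM x →ₗ[ℝ] ℝ)
    (hω : CartanGIT.IsSymplecticForm EM ω)
    (hG : CartanGIT.IsSymplecticAction EG G ω)
    (k : CartanGIT.LieDuality EG G D)
    (J : M → D) (hJ : CartanGIT.IsMomentumMap ω k J)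
    (K : CartanGIT.KleinPair EG G A)
    (ka : CartanGIT.KleinDuality K k)
    (C : CartanGIT.CartanGeometry K EP P EB B)
    (m : M) (O : CartanGIT.OrbitModel EM C m)
    (hJa : CartanGIT.IsAEquivariant O ka J)
    (hC : C.TorsionFree)
    (ζ : O.stab)
    (hζ : ∀ (p : P) (X : CartanGIT.TangentAt EP p),
      CartanGIT.lieDerivForm EP (O.act ζ) C.form p X ∈ K.sub) :
    (∃! Fζ : B → ℝ, ∀ p : P, Fζ (C.π p) = CartanGIT.futakiLift O ka J ζ p) ∧
    ∀ Fζ : B → ℝ, (∀ p : P, Fζ (C.π p) = CartanGIT.futakiLift O ka J ζ p) →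
      IsLocallyConstant Fζ ∧
        ∀ b b' : B, b' ∈ connectedComponent b → Fζ b' = Fζ b := by
  have hsurj := C.principal.surjective
  have hdesc : ∀ p q : P, C.π p = C.π q →
      CartanGIT.futakiLift O ka J ζ p = CartanGIT.futakiLift O ka J ζ q := by
    intro p q hpq
    obtain ⟨g, rfl⟩ := C.principal.exists_smul_eq hpq
    exact (CartanGIT.futakiLift_smul hJa ζ g p).symm
  -- The value is taken at an arbitrary point of the fibre; `hdesc` makes the choice harmless, and
  -- surjectivity of the projection gives uniqueness.
  refine ⟨⟨fun b => CartanGIT.futakiLift O ka J ζ (Function.surjInv hsurj b),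
    fun p => hdesc _ _ (Function.surjInv_eq hsurj _), fun F hF => ?_⟩, fun F hF => ?_⟩
  · funext b
    rw [← hF, Function.surjInv_eq hsurj]
  · have hloc : IsLocallyConstant F := by
      refine C.principal.isLocallyConstant fun c t X hc => ?_
      simp only [hF]
      exact hc.futakiLift hJ.smooth hJa hC hζ
    refine ⟨hloc, fun b b' hb' => ?_⟩
    exact hloc.apply_eq_of_isPreconnected isPreconnected_connectedComponent hb'
      mem_connectedComponent
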